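/- Let $M\ge 2$, $P>0$, $f\in(0,1]$, $T>0$. A base station with $M$ antennas serves $M$ single-antenna users over blocks of $T$ symbols. In each block the channel vectors $h_1,\dots,h_M\in\mathbb{C}^M$ have i.i.d. $\mathcal{CN}(0,1)$ entries. After half-duplex open-loop training of duration $\tau\in[0,T)$ (that is, $\tau/M$ uplink pilots of power $fP$ per user in orthogonal slots; $\tau$ is treated as a real parameter) the base station has observed $y_k=\sqrt{\tau fP/M}\,h_k+z_k$, $1\le k\le M$, where $z_1,\dots,z_M$ have i.i.d. $\mathcal{CN}(0,1)$ entries and are independent of the channels, and it forms the MMSE estimates $\hat h_k=\mathbb{E}[h_k\mid y_1,\dots,y_M]$. Let $v$ be a zero-forcing precoder: a measurable map that assigns to channel vectors $g_1,\dots,g_M$ unit vectors $v_1(g),\dots,v_M(g)\in\mathbb{C}^M$ such that $g_j^*v_k(g)=0$ for all $j\ne k$ whenever $g_1,\dots,g_M$ are linearly independent. With power $P/M$ per beam, unit-variance receiver noise, and interference treated as noise, the ergodic rate of user $k$ (natural logarithm) when the base station precodes on the basis of $g$ is $$R_k(g)=\mathbb{E}\left[\log\left(1+\frac{\frac PM|h_k^*v_k(g)|^2}{1+\sum_{j\neq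 k}\frac PM|h_k^*v_j(g)|^2}\right)\right].$$ Fix a user $k$ and put $R^{\mathrm{ZF}}=R_k(h)$ (genie-aided rate with perfect channel knowledge), $R_{\mathrm{DATA}}(\tau)=R_k(\hat h)$, $AR_{\mathrm{HD}}(\tau)=\frac{T-\tau}{T}R_{\mathrm{DATA}}(\tau)$, $\Delta AR_{\mathrm{HD}}(\tau)=R^{\mathrm{ZF}}-AR_{\mathrm{HD}}(\tau)$, and $$\widetilde T_{\mathrm{HD}}^*=\frac{\sqrt{4cT+1}-1}{2c},\qquad c=\frac{fR^{\mathrm{ZF}}}{M-1}.$$ Then $0<\widetilde T_{\mathrm{HD}}^*<T$, the function $AR_{\mathrm{HD}}$ is bounded above on $[0,T)$, and $$R^{\mathrm{ZF}}-\sup_{0\le\tau<T}AR_{\mathrm{HD}}(\tau)\;\le\;R^{\mathrm{ZF}}-AR_{\mathrm{HD}}(\widetilde T_{\mathrm{HD}}^*)\;\le\;2\sqrt{\frac{(M-1)R^{\mathrm{ZF}}}{fT}}.$$ In particular, $\Delta AR_{\mathrm{HD}}(T_{\mathrm{HD}}^*)\le R^{\mathrm{ZF}}-AR_{\mathrm{HD}}(\widetilde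 T_{\mathrm{HD}}^*)$ for every $T_{\mathrm{HD}}^*\in[0,T)$ that maximizes $AR_{\mathrm{HD}}$ over $[0,T)$. -/

import Mathlib

open MeasureTheory ProbabilityTheory

namespace HalfDuplex

/-- The circularly symmetric complex Gaussian law of mean `0` and variance `1` on `ℂ`: real and
imaginary parts are independent real Gaussians of mean `0` and variance `1 / 2`. -/
noncomputable def stdComplexGaussian : Measure ℂ :=
  ((gaussianReal 0 (1 / 2)).prod (gaussianReal 0 (1 / 2))).map Complex.measurableEquivRealProd.symm

instance : IsProbabilityMeasure stdComplexGaussian :=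
  Measure.isProbabilityMeasure_map Complex.measurableEquivRealProd.symm.measurable.aemeasurable

/-- The channels of the `M` users to the `M` antennas: row `k` is the channel vector of user `k`. -/
abbrev Channel (M : ℕ) : Type := Fin M → Fin M → ℂ

/-- A block: the true channel (first component) and the normalized additive noise at the base
station during uplink training (second component). -/
abbrev Block (M : ℕ) : Type := Channel M × Channel M

/-- The law of an array with independent standard complex Gaussian entries (Rayleigh fading,
unit variance noise). -/
noncomputable def iidGaussian (M : ℕ) : Measure (Channel M) :=
  Measure.pi fun _ => Measure.pi fun _ => stdComplexGaussian

instance (M : ℕ) : IsProbabilityMeasure (iidGaussian M) := by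
  unfold iidGaussian; infer_instance

/-- Channel and training noise are independent. -/
noncomputable def blockLaw (M : ℕ) : Measure (Block M) := (iidGaussian M).prod (iidGaussian M)

instance (M : ℕ) : IsProbabilityMeasure (blockLaw M) := by
  unfold blockLaw; infer_instance

/-- What the base station observes after a training phase of `τ` symbols, i.e. `τ / M` pilots of
power `f * P` from each user sent in orthogonal slots: for user `k` the (matched filter) observation
`√(τ f P / M) h_k + z_k`. -/
noncomputable def observation (M : ℕ) (f P τ : ℝ) (ω : Block M) : Channel M :=
  fun k m => (Real.sqrt (τ * f * P / M) : ℂ) * ω.1 k m + ω.2 k m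

/-- The MMSE estimate of the channel: the conditional expectation of every channel coefficient
given the training observation. -/
noncomputable def mmseEstimate (M : ℕ) (f P τ : ℝ) (ω : Block M) : Channel M :=
  fun k m => condExp (MeasurableSpace.comap (observation M f P τ) inferInstance) (blockLaw M)
    (fun ω' => ω'.1 k m) ω

/-- The effective power gain `|h^* v|²` of the channel `h` along the beam `v`. -/
noncomputable def gain {M : ℕ} (h v : Fin M → ℂ) : ℝ := ‖∑ m, star (h m) * v m‖ ^ 2

/-- `v` is a zero-forcing precoder: from the channel knowledge `G` it computes (measurably) a unit
norm beam `v G k` for every user `k`, which is orthogonal to the channels `G j` of the other users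
whenever the known channels are linearly independent. -/
structure IsZFPrecoder {M : ℕ} (v : Channel M → Fin M → Fin M → ℂ) : Prop where
  measurable : Measurable v
  unit_norm : ∀ (G : Channel M) (k : Fin M), ∑ m, ‖v G k m‖ ^ 2 = 1
  zero_forcing : ∀ G : Channel M, LinearIndependent ℂ G → ∀ k j : Fin M, j ≠ k →
    ∑ m, star (G j m) * v G k m = 0

/-- The ergodic rate (in nats per symbol) of user `k` when the base station precodes with `v` on the
basis of the channel knowledge `G`, every beam has power `P / M`, the noise has unit variance, and
the inter-beam interference is treated as noise. -/
noncomputable def userRate {M : ℕ} (v : Channel M → Fin M → Fin M → ℂ) (P : ℝ) (k : Fin M)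
    (G : Block M → Channel M) : ℝ :=
  ∫ ω, Real.log (1 + (P / M * gain (ω.1 k) (v (G ω) k)) /
    (1 + ∑ j ∈ Finset.univ.erase k, P / M * gain (ω.1 k) (v (G ω) j))) ∂(blockLaw M)

/-- The genie-aided rate `R^ZF`: the base station knows the true channel. -/
noncomputable def rateZF {M : ℕ} (v : Channel M → Fin M → Fin M → ℂ) (P : ℝ) (k : Fin M) : ℝ :=
  userRate v P k Prod.fst

/-- The downlink rate `R_DATA(τ)` after open-loop training of duration `τ`. -/
noncomputable def rateData {M : ℕ} (v : Channel M → Fin M → Fin M → ℂ) (f P : ℝ) (k : Fin M)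
    (τ : ℝ) : ℝ :=
  userRate v P k (mmseEstimate M f P τ)

/-- The half-duplex spectral efficiency `AR_HD(τ)` in blocks of length `T`. -/
noncomputable def arHD {M : ℕ} (v : Channel M → Fin M → Fin M → ℂ) (f P : ℝ) (k : Fin M)
    (T τ : ℝ) : ℝ :=
  (T - τ) / T * rateData v f P k τ

/-- The loss `ΔAR_HD(τ)` of spectral efficiency relative to the genie-aided system. -/
noncomputable def lossHD {M : ℕ} (v : Channel M → Fin M → Fin M → ℂ) (f P : ℝ) (k : Fin M)
    (T τ : ℝ) : ℝ :=
  rateZF v P k - arHD v f P k T τ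

/-- The constant `c = f R^ZF / (M - 1)`. -/
noncomputable def cHD {M : ℕ} (v : Channel M → Fin M → Fin M → ℂ) (f P : ℝ) (k : Fin M) : ℝ :=
  f * rateZF v P k / ((M : ℝ) - 1)

/-- The approximately optimal training duration `(√(4 c T + 1) - 1) / (2 c)`. -/
noncomputable def approxOptHD {M : ℕ} (v : Channel M → Fin M → Fin M → ℂ) (f P : ℝ) (k : Fin M)
    (T : ℝ) : ℝ :=
  (Real.sqrt (4 * cHD v f P k * T + 1) - 1) / (2 * cHD v f P k)

end HalfDuplex

namespace HalfDuplex

/-! ### The complex Gaussian law -/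

/-! With `q = τ f P / M`, `s = √(1 + q)`, `a = √q / s` and `b = 1 / s`, a reflection of each pair
(channel entry, noise entry) gives new i.i.d. Gaussian arrays `u`, `w` with `h = a u + b w` and
observation `s u`. Hence the MMSE estimate is `a u` (`mmseEstimate_ae_eq`) and the data rate is
`mixtureRate` with parameters `a`, `b`. The user's own beam is fixed, up to a phase, by the other
users' rows, so the signal gain has the law of `‖x‖ ^ 2` under `stdComplexGaussian`, exactly as with
perfect knowledge (`identDistrib_signal`). Zero forcing removes the known part `a u` from the
interference; each of the `M - 1` foreign beams leaves power of mean `(P / M) b ^ 2 ≤ 1 / (f τ)`.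
With `log (1 + S / (1 + I)) ≥ log (1 + S) - I` the rate loss is at most `(M - 1) / (f τ)`. The total
loss is then at most the overhead `R τ / T` plus `(T - τ) / T` times this rate loss. The chosen
duration makes the two terms equal. -/

lemma charFunDual_stdComplexGaussian (L : StrongDual ℝ ℂ) :
    charFunDual stdComplexGaussian L =
      Complex.exp (-((L 1 : ℂ) ^ 2 + (L Complex.I : ℂ) ^ 2) / 4) := by
  have hL : ∀ a b : ℝ, L ⟨a, b⟩ = L 1 * a + L Complex.I * b := by
    intro a b
    have : (⟨a, b⟩ : ℂ) = a • (1 : ℂ) + b • Complex.I := by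
      apply Complex.ext <;> simp
    rw [this, map_add, map_smul, map_smul, smul_eq_mul, smul_eq_mul, mul_comm, mul_comm b]
  rw [charFunDual_apply, stdComplexGaussian, integral_map_equiv]
  have : ∀ p : ℝ × ℝ, Complex.exp ((L (Complex.measurableEquivRealProd.symm p) : ℂ) * Complex.I) =
      Complex.exp ((L 1 : ℝ) * p.1 * Complex.I) *
        Complex.exp ((L Complex.I : ℝ) * p.2 * Complex.I) := by
    intro p
    rw [← Complex.exp_add, show Complex.measurableEquivRealProd.symm p = ⟨p.1, p.2⟩ from rfl, hL]
    push_cast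
    ring_nf
  simp_rw [this]
  rw [integral_prod_mul (fun x : ℝ => Complex.exp ((L 1 : ℝ) * x * Complex.I))
    (fun x : ℝ => Complex.exp ((L Complex.I : ℝ) * x * Complex.I)),
    ← charFun_apply_real, ← charFun_apply_real, charFun_gaussianReal, charFun_gaussianReal,
    ← Complex.exp_add]
  congr 1
  push_cast
  ring

lemma stdComplexGaussian_singleton_zero : stdComplexGaussian {0} = 0 := by
  have hnull := nullSingletonClass_gaussianReal (μ := 0) (v := 1 / 2) (by norm_num)
  rw [stdComplexGaussian, MeasurableEquiv.map_apply]
  have : Complex.measurableEquivRealProd.symm ⁻¹' {(0 : ℂ)} = {(0 : ℝ)} ×ˢ {(0 : ℝ)} := by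
    ext p
    rw [Set.mem_preimage, Set.mem_singleton_iff,
      show Complex.measurableEquivRealProd.symm p = ⟨p.1, p.2⟩ from rfl]
    simp [Complex.ext_iff, Prod.ext_iff]
  rw [this, Measure.prod_prod, measure_singleton, zero_mul]

lemma integral_gaussianReal_zero_sq (s : NNReal) : ∫ x, x ^ 2 ∂(gaussianReal 0 s) = s := by
  have h := variance_id_gaussianReal (μ := 0) (v := s)
  rw [variance_eq_integral measurable_id.aemeasurable] at h
  simpa using h

lemma integrable_sq_gaussianReal (s : NNReal) :
    Integrable (fun x => x ^ 2) (gaussianReal 0 s) :=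
  (memLp_id_gaussianReal (μ := 0) (v := s) 2).integrable_sq

lemma integrable_id_gaussianReal (s : NNReal) :
    Integrable (fun x => x) (gaussianReal 0 s) :=
  (memLp_id_gaussianReal (μ := 0) (v := s) 1).integrable le_rfl

lemma integrable_normSq_stdComplexGaussian :
    Integrable (fun x : ℂ => ‖x‖ ^ 2) stdComplexGaussian := by
  rw [stdComplexGaussian, integrable_map_equiv]
  have : ((fun x : ℂ => ‖x‖ ^ 2) ∘ Complex.measurableEquivRealProd.symm) =
      fun p : ℝ × ℝ => p.1 ^ 2 + p.2 ^ 2 := by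
    ext p
    rw [Function.comp, show Complex.measurableEquivRealProd.symm p = ⟨p.1, p.2⟩ from rfl,
      Complex.sq_norm, Complex.normSq_mk]
    ring
  rw [this]
  exact ((integrable_sq_gaussianReal _).comp_fst _).add ((integrable_sq_gaussianReal _).comp_snd _)

lemma integral_normSq_stdComplexGaussian : ∫ x, ‖x‖ ^ 2 ∂stdComplexGaussian = 1 := by
  rw [stdComplexGaussian, integral_map_equiv]
  have : ∀ p, ‖Complex.measurableEquivRealProd.symm p‖ ^ 2 = p.1 ^ 2 + p.2 ^ 2 := by
    intro p
    rw [show Complex.measurableEquivRealProd.symm p = ⟨p.1, p.2⟩ from rfl,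
      Complex.sq_norm, Complex.normSq_mk]
    ring
  simp_rw [this]
  rw [integral_add ((integrable_sq_gaussianReal _).comp_fst _)
    ((integrable_sq_gaussianReal _).comp_snd _)]
  rw [integral_fun_fst (fun x : ℝ => x ^ 2), integral_fun_snd (fun x : ℝ => x ^ 2),
    integral_gaussianReal_zero_sq]
  simp
  norm_num

lemma integrable_id_stdComplexGaussian : Integrable (fun x : ℂ => x) stdComplexGaussian := by
  have h : MemLp (fun x : ℂ => x) 2 stdComplexGaussian :=
    (memLp_two_iff_integrable_sq_norm (by fun_prop)).2 integrable_normSq_stdComplexGaussian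
  exact h.integrable (by norm_num)

lemma integral_id_stdComplexGaussian : ∫ x, x ∂stdComplexGaussian = 0 := by
  have h1 : Integrable (fun p : ℝ × ℝ => (p.1 : ℂ))
      ((gaussianReal 0 (1 / 2)).prod (gaussianReal 0 (1 / 2))) :=
    ((integrable_id_gaussianReal _).comp_fst _).ofReal
  have h2 : Integrable (fun p : ℝ × ℝ => (p.2 : ℂ) * Complex.I)
      ((gaussianReal 0 (1 / 2)).prod (gaussianReal 0 (1 / 2))) :=
    ((integrable_id_gaussianReal _).comp_snd _).ofReal.mul_const _
  rw [stdComplexGaussian, integral_map_equiv]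
  have : ∀ p, Complex.measurableEquivRealProd.symm p = (p.1 : ℂ) + p.2 * Complex.I := by
    intro p
    rw [show Complex.measurableEquivRealProd.symm p = ⟨p.1, p.2⟩ from rfl]
    exact (Complex.mk_eq_add_mul_I _ _)
  simp_rw [this]
  rw [integral_add h1 h2, integral_fun_fst (fun x : ℝ => (x : ℂ)),
    integral_fun_snd (fun x : ℝ => (x : ℂ) * Complex.I), integral_mul_const]
  have h0 : ∫ x : ℝ, (x : ℂ) ∂(gaussianReal 0 (1 / 2)) = 0 := by
    rw [integral_complex_ofReal, integral_id_gaussianReal, Complex.ofReal_zero]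
  simp only [h0, zero_mul, smul_zero, add_zero]

/-! ### Orthogonal transformations of Gaussian arrays -/

/-- The reflection of a pair with direction `(a, b)`. -/
noncomputable def pairReflection (a b : ℝ) (p : ℂ × ℂ) : ℂ × ℂ :=
  (a * p.1 + b * p.2, b * p.1 - a * p.2)

/-- The characteristic functional determines the law, and its exponent is a sum of squares of
coordinates of `L`. The reflection transforms these orthogonally, so the cross terms cancel. -/
lemma measurePreserving_pairReflection {a b : ℝ} (hab : a ^ 2 + b ^ 2 = 1) :
    MeasurePreserving (pairReflection a b) (stdComplexGaussian.prod stdComplexGaussian)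
      (stdComplexGaussian.prod stdComplexGaussian) := by
  let F : ℂ × ℂ →L[ℝ] ℂ × ℂ :=
    (a • ContinuousLinearMap.fst ℝ ℂ ℂ + b • ContinuousLinearMap.snd ℝ ℂ ℂ).prod
      (b • ContinuousLinearMap.fst ℝ ℂ ℂ - a • ContinuousLinearMap.snd ℝ ℂ ℂ)
  have hF : pairReflection a b = F := by
    ext p <;> simp [F, pairReflection]
  rw [hF]
  refine ⟨F.continuous.measurable, Measure.ext_of_charFunDual (funext fun L => ?_)⟩
  rw [charFunDual_map, charFunDual_prod, charFunDual_prod]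
  simp only [charFunDual_stdComplexGaussian, ← Complex.exp_add]
  congr 1
  have hL : ∀ z w : ℂ, L (z, w) = L (z, 0) + L (0, w) := by
    intro z w
    rw [← map_add]
    simp
  have h1 : ∀ z : ℂ, L (F (z, 0)) = a * L (z, 0) + b * L (0, z) := by
    intro z
    have : F (z, 0) = a • (z, 0) + b • (0, z) := by simp [F]
    rw [this, map_add, map_smul, map_smul, smul_eq_mul, smul_eq_mul]
  have h2 : ∀ z : ℂ, L (F (0, z)) = b * L (z, 0) - a * L (0, z) := by
    intro z
    have : F (0, z) = b • (z, 0) - a • (0, z) := by simp [F]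
    rw [this, map_sub, map_smul, map_smul, smul_eq_mul, smul_eq_mul]
  simp only [ContinuousLinearMap.comp_apply, ContinuousLinearMap.inl_apply,
    ContinuousLinearMap.inr_apply, h1, h2]
  have hab' : (a : ℂ) ^ 2 + (b : ℂ) ^ 2 = 1 := by exact_mod_cast hab
  push_cast
  linear_combination (-((L (1, 0) : ℂ) ^ 2 + (L (0, 1) : ℂ) ^ 2 + (L (Complex.I, 0) : ℂ) ^ 2
    + (L (0, Complex.I) : ℂ) ^ 2) / 4) * hab'

/-- A pair of families is regrouped as a family of pairs, on which the maps act coordinatewise. It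
is applied twice below: over users, then over antennas. -/
lemma measurePreserving_pi_pair {ι α : Type*} [Fintype ι] [MeasurableSpace α]
    (μ : ι → Measure α) [∀ i, SigmaFinite (μ i)] (g : ι → α × α → α × α)
    (hg : ∀ i, MeasurePreserving (g i) ((μ i).prod (μ i)) ((μ i).prod (μ i))) :
    MeasurePreserving
      (fun p : (ι → α) × (ι → α) =>
        ((fun i => (g i (p.1 i, p.2 i)).1, fun i => (g i (p.1 i, p.2 i)).2) : (ι → α) × (ι → α)))
      ((Measure.pi μ).prod (Measure.pi μ)) ((Measure.pi μ).prod (Measure.pi μ)) := by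
  have h := measurePreserving_arrowProdEquivProdArrow α α ι μ μ
  exact (h.comp (measurePreserving_pi _ _ hg)).comp (h.symm _)

/-- The row-dependent reflection of a pair of arrays. -/
noncomputable def blockReflection {M : ℕ} (a b : Fin M → ℝ) (ω : Block M) : Block M :=
  (fun i m => a i * ω.1 i m + b i * ω.2 i m, fun i m => b i * ω.1 i m - a i * ω.2 i m)

lemma measurePreserving_blockReflection {M : ℕ} {a b : Fin M → ℝ}
    (hab : ∀ i, a i ^ 2 + b i ^ 2 = 1) :
    MeasurePreserving (blockReflection a b) (blockLaw M) (blockLaw M) :=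
  measurePreserving_pi_pair _ _ fun i =>
    measurePreserving_pi_pair _ _ fun _ => measurePreserving_pairReflection (hab i)

/-- The reason for reflections instead of rotations: being an involution, the same map recovers the
channel from the new coordinates. -/
lemma blockReflection_blockReflection {M : ℕ} {a b : Fin M → ℝ}
    (hab : ∀ i, a i ^ 2 + b i ^ 2 = 1) (ω : Block M) :
    blockReflection a b (blockReflection a b ω) = ω := by
  have hab' : ∀ i, (a i : ℂ) ^ 2 + (b i : ℂ) ^ 2 = 1 := fun i => by exact_mod_cast hab i
  refine Prod.ext (funext₂ fun i m => ?_) (funext₂ fun i m => ?_) <;> simp only [blockReflection]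
  · linear_combination ω.1 i m * hab' i
  · linear_combination ω.2 i m * hab' i

/-! ### The projection of a Gaussian vector on a unit vector -/

/-- The law of a vector with independent standard complex Gaussian entries. -/
noncomputable def vectorLaw (M : ℕ) : Measure (Fin M → ℂ) := Measure.pi fun _ => stdComplexGaussian

instance (M : ℕ) : IsProbabilityMeasure (vectorLaw M) := by
  unfold vectorLaw; infer_instance

/-- By circular symmetry, entry `m` contributes `‖e m‖ ^ 2` times the exponent of a standard
Gaussian, and these weights sum to one. -/
lemma measurePreserving_projection {M : ℕ} {e : Fin M → ℂ} (he : ∑ m, ‖e m‖ ^ 2 = 1) :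
    MeasurePreserving (fun x : Fin M → ℂ => ∑ m, star (x m) * e m) (vectorLaw M)
      stdComplexGaussian := by
  let F : (Fin M → ℂ) →L[ℝ] ℂ :=
    ∑ m, ((ContinuousLinearMap.mul ℝ ℂ).flip (e m)).comp
      ((Complex.conjCLE : ℂ →L[ℝ] ℂ).comp (ContinuousLinearMap.proj m))
  have hF : (fun x : Fin M → ℂ => ∑ m, star (x m) * e m) = F := by
    ext x
    simp [F, mul_comm]
  rw [hF]
  refine ⟨F.continuous.measurable, Measure.ext_of_charFunDual (funext fun L => ?_)⟩
  rw [charFunDual_map, vectorLaw, charFunDual_pi]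
  simp only [charFunDual_stdComplexGaussian, ← Complex.exp_sum]
  congr 1
  have hF' : ∀ (m : Fin M) (z : ℂ), F (Pi.single m z) = star z * e m := by
    intro m z
    rw [← hF]
    simp only []
    rw [Finset.sum_eq_single m]
    · simp
    · intro j _ hj
      simp [hj]
    · simp
  have hL : ∀ z : ℂ, L z = z.re * L 1 + z.im * L Complex.I := by
    intro z
    have : z = z.re • (1 : ℂ) + z.im • Complex.I := by
      apply Complex.ext <;> simp
    conv_lhs => rw [this]
    rw [map_add, map_smul, map_smul, smul_eq_mul, smul_eq_mul]
  have key : ∀ m, (L (star 1 * e m)) ^ 2 + (L (star Complex.I * e m)) ^ 2 =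
      ‖e m‖ ^ 2 * ((L 1) ^ 2 + (L Complex.I) ^ 2) := by
    intro m
    rw [hL (star 1 * e m), hL (star Complex.I * e m), Complex.sq_norm, Complex.normSq_apply]
    simp
    ring
  simp only [ContinuousLinearMap.comp_apply, ContinuousLinearMap.single_apply, hF']
  have : ∑ m, (-((L (star 1 * e m)) ^ 2 + (L (star Complex.I * e m)) ^ 2) / 4 : ℝ) =
      -((L 1) ^ 2 + (L Complex.I) ^ 2) / 4 := by
    simp_rw [key]
    rw [← Finset.sum_div, Finset.sum_neg_distrib, ← Finset.sum_mul, he, one_mul]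
  exact_mod_cast this

variable {M : ℕ}

/-! ### Almost sure linear independence -/

lemma exists_unit_projection_eq_zero {S : Submodule ℂ (Fin M → ℂ)} (hS : S < ⊤) :
    ∃ e : Fin M → ℂ, ∑ m, ‖e m‖ ^ 2 = 1 ∧ ∀ x ∈ S, ∑ m, star (x m) * e m = 0 := by
  obtain ⟨f, hf, hfS⟩ := S.exists_le_ker_of_lt_top hS
  set c : Fin M → ℂ := fun m => f (Pi.single m 1) with hc
  have hfc : ∀ x, f x = ∑ m, x m * c m := by
    intro x
    rw [f.pi_apply_eq_sum_univ x]
    simp only [smul_eq_mul, hc]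
    refine Finset.sum_congr rfl fun m _ => ?_
    congr 2
    ext j
    simp [Pi.single_apply, eq_comm]
  have hN : 0 < ∑ m, ‖c m‖ ^ 2 := by
    refine (Finset.sum_nonneg fun m _ => sq_nonneg _).lt_of_ne fun h => hf ?_
    rw [eq_comm, Finset.sum_eq_zero_iff_of_nonneg fun m _ => sq_nonneg _] at h
    refine LinearMap.ext fun x => ?_
    rw [hfc, LinearMap.zero_apply]
    refine Finset.sum_eq_zero fun m hm => ?_
    have h0 : c m = 0 := norm_eq_zero.1 (pow_eq_zero_iff two_ne_zero |>.1 (h m hm))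
    rw [h0, mul_zero]
  refine ⟨fun m => ((Real.sqrt (∑ m, ‖c m‖ ^ 2) : ℝ) : ℂ)⁻¹ * star (c m), ?_, fun x hx => ?_⟩
  · simp only [norm_mul, mul_pow, norm_inv, norm_star]
    rw [← Finset.mul_sum, Complex.norm_real, Real.norm_eq_abs, inv_pow, sq_abs,
      Real.sq_sqrt hN.le, inv_mul_cancel₀ hN.ne']
  · have h0 : ∑ m, x m * c m = 0 := by rw [← hfc]; exact hfS hx
    have h1 : ∑ m, star (x m) * star (c m) = 0 := by
      have := congrArg star h0
      simpa [star_sum, mul_comm] using this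
    calc _ = ((Real.sqrt (∑ m, ‖c m‖ ^ 2) : ℝ) : ℂ)⁻¹ * ∑ m, star (x m) * star (c m) := by
          rw [Finset.mul_sum]
          exact Finset.sum_congr rfl fun m _ => by ring
      _ = 0 := by rw [h1, mul_zero]

/-- The subspace lies in a hyperplane; the projection on its unit normal is Gaussian and has no atom
at `0`. -/
lemma vectorLaw_submodule {S : Submodule ℂ (Fin M → ℂ)} (hS : S < ⊤) :
    vectorLaw M (S : Set (Fin M → ℂ)) = 0 := by
  obtain ⟨e, he, heS⟩ := exists_unit_projection_eq_zero hS
  refine measure_mono_null (t := (fun x : Fin M → ℂ => ∑ m, star (x m) * e m) ⁻¹' {0})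
    (fun x hx => heS x hx) ?_
  rw [(measurePreserving_projection he).measure_preimage (measurableSet_singleton 0).nullMeasurableSet]
  exact stdComplexGaussian_singleton_zero

lemma ae_linearIndependent_pi (n : ℕ) (hn : n ≤ M) :
    ∀ᵐ G ∂(Measure.pi fun _ : Fin n => vectorLaw M), LinearIndependent ℂ G := by
  induction n with
  | zero => exact Filter.Eventually.of_forall fun G => linearIndependent_empty_type
  | succ n ih =>
    have hmp := measurePreserving_piFinSuccAbove (fun _ : Fin (n + 1) => vectorLaw M) 0
    have hmeas : MeasurableSet {p : (Fin M → ℂ) × (Fin n → Fin M → ℂ) |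
        LinearIndependent ℂ (Fin.cons p.1 p.2 : Fin (n + 1) → Fin M → ℂ)} := by
      have hcont : Continuous fun p : (Fin M → ℂ) × (Fin n → Fin M → ℂ) =>
          (Fin.cons p.1 p.2 : Fin (n + 1) → Fin M → ℂ) := by
        fun_prop
      exact (isOpen_setOfPred_linearIndependent.preimage hcont).measurableSet
    have key : ∀ᵐ p ∂((vectorLaw M).prod (Measure.pi fun _ : Fin n => vectorLaw M)),
        LinearIndependent ℂ (Fin.cons p.1 p.2 : Fin (n + 1) → Fin M → ℂ) := by
      -- The order of the quantifiers is swapped so that the `n` later rows are fixed first. As `n <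
      -- M` their span is proper, and the new row almost surely avoids it.
      rw [Measure.ae_prod_iff_ae_ae hmeas, Measure.ae_ae_comm hmeas]
      filter_upwards [ih (by omega)] with G hG
      have hlt : Submodule.span ℂ (Set.range G) < ⊤ := by
        refine lt_top_iff_ne_top.2 fun h => ?_
        have := finrank_le_of_span_eq_top h
        simp at this
        omega
      rw [ae_iff]
      refine measure_mono_null (fun x hx => ?_) (vectorLaw_submodule hlt)
      simp only [Set.mem_ofPred_eq, linearIndependent_finCons, not_and, not_not] at hx
      exact hx hG
    filter_upwards [hmp.quasiMeasurePreserving.ae key] with G hG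
    convert hG using 1
    exact (Fin.cons_self_tail G).symm

lemma ae_linearIndependent : ∀ᵐ G ∂(iidGaussian M), LinearIndependent ℂ G :=
  ae_linearIndependent_pi M le_rfl

lemma ae_linearIndependent_fst {c : ℝ} (hc : c ≠ 0) :
    ∀ᵐ ω ∂(blockLaw M), LinearIndependent ℂ (fun i m => (c : ℂ) * ω.1 i m) := by
  have h : ∀ᵐ ω ∂(blockLaw M), LinearIndependent ℂ ω.1 :=
    Measure.quasiMeasurePreserving_fst.ae ae_linearIndependent
  filter_upwards [h] with ω hω
  exact hω.units_smul fun _ => Units.mk0 (c : ℂ) (by exact_mod_cast hc)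

/-! ### Gains along beams -/

lemma gain_nonneg (x e : Fin M → ℂ) : 0 ≤ gain x e := sq_nonneg _

lemma measurable_gain {α : Type*} [MeasurableSpace α] {f g : α → Fin M → ℂ} (hf : Measurable f)
    (hg : Measurable g) : Measurable fun x => gain (f x) (g x) := by
  have hm : ∀ m, Measurable fun x => star (f x m) * g x m := fun m =>
    (Complex.continuous_conj.measurable.comp ((measurable_pi_apply m).comp hf)).mul
      ((measurable_pi_apply m).comp hg)
  have hsum : Measurable fun x => ∑ m, star (f x m) * g x m :=
    Finset.measurable_fun_sum _ fun m _ => hm m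
  exact hsum.norm.pow_const 2

lemma gain_le {x e : Fin M → ℂ} (he : ∑ m, ‖e m‖ ^ 2 = 1) : gain x e ≤ ∑ m, ‖x m‖ ^ 2 := by
  calc gain x e ≤ (∑ m, ‖x m‖ * ‖e m‖) ^ 2 := by
        unfold gain
        gcongr
        refine (norm_sum_le _ _).trans_eq (Finset.sum_congr rfl fun m _ => ?_)
        rw [norm_mul, norm_star]
    _ ≤ (∑ m, ‖x m‖ ^ 2) * ∑ m, ‖e m‖ ^ 2 := Finset.sum_mul_sq_le_sq_mul_sq _ _ _
    _ = ∑ m, ‖x m‖ ^ 2 := by rw [he, mul_one]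

lemma gain_const_mul (x e : Fin M → ℂ) (c : ℂ) :
    gain x (fun m => c * e m) = ‖c‖ ^ 2 * gain x e := by
  unfold gain
  rw [← mul_pow, ← norm_mul, Finset.mul_sum]
  congr 2
  exact Finset.sum_congr rfl fun m _ => by ring

lemma gain_add_of_orthogonal {x e : Fin M → ℂ} (h : ∑ m, star (x m) * e m = 0)
    (y : Fin M → ℂ) (b : ℝ) :
    gain (fun m => x m + b * y m) e = b ^ 2 * gain y e := by
  unfold gain
  have : ∑ m, star (x m + b * y m) * e m = b * ∑ m, star (y m) * e m := by
    rw [← zero_add (_ * _), ← h, Finset.mul_sum, ← Finset.sum_add_distrib]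
    refine Finset.sum_congr rfl fun m _ => ?_
    simp only [star_add, star_mul', Complex.star_def, Complex.conj_ofReal]
    ring
  rw [this, norm_mul, mul_pow, Complex.norm_real, Real.norm_eq_abs, sq_abs]

/-- `M` independent rows span the whole space, so `w` is orthogonal to itself. -/
lemma eq_zero_of_orthogonal {G : Channel M} (hG : LinearIndependent ℂ G) {w : Fin M → ℂ}
    (hw : ∀ j, ∑ m, star (G j m) * w m = 0) : w = 0 := by
  have hspan := hG.span_eq_top_of_card_eq_finrank' (by simp)
  have h : ∀ x ∈ Submodule.span ℂ (Set.range G), ∑ m, star (x m) * w m = 0 := by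
    intro x hx
    induction hx using Submodule.span_induction with
    | mem x hx => obtain ⟨j, rfl⟩ := hx; exact hw j
    | zero => simp
    | add x y _ _ hx hy => simp [add_mul, Finset.sum_add_distrib] at hx hy ⊢; simp [hx, hy]
    | smul c x _ hx =>
      have : ∑ m, star ((c • x) m) * w m = star c * ∑ m, star (x m) * w m := by
        rw [Finset.mul_sum]
        exact Finset.sum_congr rfl fun m _ => by simp [mul_assoc]
      rw [this, hx, mul_zero]
  have hww := h w (by rw [hspan]; trivial)
  have hsum : ∑ m, ‖w m‖ ^ 2 = 0 := by
    have : ((∑ m, ‖w m‖ ^ 2 : ℝ) : ℂ) = 0 := by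
      rw [← hww]
      push_cast
      exact Finset.sum_congr rfl fun m _ => (Complex.conj_mul' (w m)).symm
    exact_mod_cast this
  rw [Finset.sum_eq_zero_iff_of_nonneg fun m _ => sq_nonneg _] at hsum
  ext m
  simpa using hsum m (Finset.mem_univ m)

/-- The gain along a unit beam orthogonal to all rows but one of a basis does not depend on the
choice of that beam. -/
lemma gain_eq_gain_of_orthogonal {G : Channel M} (hG : LinearIndependent ℂ G) {k : Fin M}
    {e e' : Fin M → ℂ} (he : ∑ m, ‖e m‖ ^ 2 = 1) (he' : ∑ m, ‖e' m‖ ^ 2 = 1)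
    (ho : ∀ j, j ≠ k → ∑ m, star (G j m) * e m = 0)
    (ho' : ∀ j, j ≠ k → ∑ m, star (G j m) * e' m = 0) (x : Fin M → ℂ) :
    gain x e = gain x e' := by
  set a := ∑ m, star (G k m) * e m with ha
  set a' := ∑ m, star (G k m) * e' m with ha'
  have ha0 : a ≠ 0 := by
    intro h
    have : e = 0 := eq_zero_of_orthogonal hG fun j => by
      by_cases hj : j = k
      · rw [hj, ← ha, h]
      · exact ho j hj
    simp [this] at he
  -- The coefficients are chosen so that the product with row `k` vanishes as well; the two beams
  -- are therefore proportional.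
  have hw : (fun m => a * e' m - a' * e m) = 0 := by
    refine eq_zero_of_orthogonal hG fun j => ?_
    have : ∑ m, star (G j m) * (a * e' m - a' * e m) =
        a * ∑ m, star (G j m) * e' m - a' * ∑ m, star (G j m) * e m := by
      rw [Finset.mul_sum, Finset.mul_sum, ← Finset.sum_sub_distrib]
      exact Finset.sum_congr rfl fun m _ => by ring
    rw [this]
    by_cases hj : j = k
    · rw [hj, ← ha, ← ha']
      ring
    · rw [ho j hj, ho' j hj]
      simp
  have hfun : (fun m => a * e' m) = fun m => a' * e m := by
    ext m
    have := congrFun hw m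
    exact sub_eq_zero.1 this
  have hnorm : ‖a‖ ^ 2 = ‖a'‖ ^ 2 := by
    have h1 : ∑ m, ‖a * e' m‖ ^ 2 = ∑ m, ‖a' * e m‖ ^ 2 :=
      Finset.sum_congr rfl fun m _ => by rw [congrFun hfun m]
    simpa only [norm_mul, mul_pow, ← Finset.mul_sum, he, he', mul_one] using h1
  have hgain : ‖a‖ ^ 2 * gain x e' = ‖a‖ ^ 2 * gain x e := by
    rw [← gain_const_mul, hfun, gain_const_mul, hnorm]
  exact (mul_left_cancel₀ (pow_ne_zero 2 (norm_ne_zero_iff.2 ha0)) hgain).symm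

/-! ### Laws of the gains -/

lemma measurePreserving_row (k : Fin M) :
    MeasurePreserving (fun G : Channel M => G k) (iidGaussian M) (vectorLaw M) :=
  measurePreserving_eval (fun _ : Fin M => vectorLaw M) k

/-- By Fubini: once the first component is fixed, the beam is a constant unit vector, and the
resulting law does not depend on it. -/
lemma measurePreserving_independent_projection {e : Channel M → Fin M → ℂ} (hem : Measurable e)
    (he : ∀ u, ∑ m, ‖e u m‖ ^ 2 = 1) (k : Fin M) :
    MeasurePreserving (fun ω : Block M => ∑ m, star (ω.2 k m) * e ω.1 m) (blockLaw M)
      stdComplexGaussian := by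
  have hmeas : Measurable fun ω : Block M => ∑ m, star (ω.2 k m) * e ω.1 m := by
    have h1 : Measurable fun ω : Block M => (ω.2 k, e ω.1) :=
      ((measurable_pi_apply k).comp measurable_snd).prodMk (hem.comp measurable_fst)
    have h2 : Measurable fun p : (Fin M → ℂ) × (Fin M → ℂ) => ∑ m, star (p.1 m) * p.2 m := by
      have : Continuous fun p : (Fin M → ℂ) × (Fin M → ℂ) => ∑ m, star (p.1 m) * p.2 m := by
        fun_prop
      exact this.measurable
    exact h2.comp h1
  refine ⟨hmeas, Measure.ext fun s hs => ?_⟩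
  rw [Measure.map_apply hmeas hs, blockLaw, Measure.prod_apply (hmeas hs)]
  have : ∀ u : Channel M, iidGaussian M (Prod.mk u ⁻¹'
      ((fun ω : Block M => ∑ m, star (ω.2 k m) * e ω.1 m) ⁻¹' s)) = stdComplexGaussian s :=
    fun u => ((measurePreserving_projection (he u)).comp
      (measurePreserving_row k)).measure_preimage hs.nullMeasurableSet
  simp_rw [this]
  simp

lemma identDistrib_gain_independent {e : Channel M → Fin M → ℂ} (hem : Measurable e)
    (he : ∀ u, ∑ m, ‖e u m‖ ^ 2 = 1) (k : Fin M) :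
    IdentDistrib (fun ω : Block M => gain (ω.2 k) (e ω.1)) (fun x : ℂ => ‖x‖ ^ 2) (blockLaw M)
      stdComplexGaussian := by
  have h := measurePreserving_independent_projection hem he k
  have : IdentDistrib (fun ω : Block M => ∑ m, star (ω.2 k m) * e ω.1 m) (fun x : ℂ => x)
      (blockLaw M) stdComplexGaussian :=
    ⟨h.measurable.aemeasurable, measurable_id.aemeasurable, by
      rw [h.map_eq]; exact Measure.map_id.symm⟩
  exact this.comp (u := fun x : ℂ => ‖x‖ ^ 2) (by fun_prop)

/-- The channel of which `a • ω.1` is the known part. -/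
noncomputable def mixture (a b : ℝ) (ω : Block M) : Channel M :=
  fun i m => a * ω.1 i m + b * ω.2 i m

/-- The known part of the channel `mixture a b`. -/
noncomputable def scaled (a : ℝ) (u : Channel M) : Channel M := fun i m => a * u i m

lemma measurable_scaled (a : ℝ) : Measurable (scaled (M := M) a) := by
  have : Continuous (scaled (M := M) a) := by
    unfold scaled
    fun_prop
  exact this.measurable

lemma measurable_mixture (a b : ℝ) : Measurable (mixture (M := M) a b) := by
  have : Continuous (mixture (M := M) a b) := by
    unfold mixture
    fun_prop
  exact this.measurable

variable {v : Channel M → Fin M → Fin M → ℂ}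

lemma IsZFPrecoder.measurable_beam (hv : IsZFPrecoder v) (a : ℝ) (j : Fin M) :
    Measurable fun u : Channel M => v (scaled a u) j :=
  (measurable_pi_apply j).comp (hv.measurable.comp (measurable_scaled a))

lemma IsZFPrecoder.measurable_gain_mixture (hv : IsZFPrecoder v) (a b : ℝ) (k j : Fin M) :
    Measurable fun ω : Block M => gain (mixture a b ω k) (v (scaled a ω.1) j) := by
  have h1 : Measurable fun ω : Block M => mixture a b ω k :=
    (measurable_pi_apply k).comp (measurable_mixture a b)
  have h2 : Measurable fun ω : Block M => v (scaled a ω.1) j :=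
    (hv.measurable_beam a j).comp measurable_fst
  exact measurable_gain h1 h2

/-- The effective gain of a user along the own beam is exponentially distributed, whatever the
quality of the channel knowledge. -/
lemma IsZFPrecoder.identDistrib_signal (hv : IsZFPrecoder v) {a b : ℝ} (hab : a ^ 2 + b ^ 2 = 1)
    (ha : a ≠ 0) (k : Fin M) :
    IdentDistrib (fun ω : Block M => gain (mixture a b ω k) (v (scaled a ω.1) k))
      (fun x : ℂ => ‖x‖ ^ 2) (blockLaw M) stdComplexGaussian := by
  -- This reflection puts row `k` of the mixture into the second component, independent of the
  -- first, and leaves the other rows of the first component unchanged. Replacing row `k` there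
  -- alters beam `k` only by a phase, so the gain is that of an independent channel row.
  set A : Fin M → ℝ := fun i => if i = k then -b else 1 with hA
  set B : Fin M → ℝ := fun i => if i = k then a else 0 with hB
  have hAB : ∀ i, A i ^ 2 + B i ^ 2 = 1 := by
    intro i
    by_cases hi : i = k <;> simp [hA, hB, hi]
    linarith
  have hR := measurePreserving_blockReflection hAB
  have hind := identDistrib_gain_independent (hv.measurable_beam a k) (fun u => hv.unit_norm _ k) k
  set g : Block M → ℝ := fun ω => gain (ω.2 k) (v (scaled a ω.1) k) with hg
  have hcomp : IdentDistrib (g ∘ blockReflection A B) g (blockLaw M) (blockLaw M) :=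
    (⟨hR.measurable.aemeasurable, measurable_id.aemeasurable, by
      rw [hR.map_eq, Measure.map_id]⟩ :
      IdentDistrib (blockReflection A B) id (blockLaw M) (blockLaw M)).comp_of_aemeasurable (by
        rw [hR.map_eq]; exact hind.aemeasurable_fst)
  refine (IdentDistrib.of_ae_eq (hv.measurable_gain_mixture a b k k).aemeasurable ?_).trans
    (hcomp.trans hind)
  have hli := ae_linearIndependent_fst (M := M) ha
  filter_upwards [hli, hR.quasiMeasurePreserving.ae hli] with ω hω hω'
  have h2 : (blockReflection A B ω).2 k = mixture a b ω k := by
    ext m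
    simp [blockReflection, mixture, hA, hB]
  simp only [Function.comp, hg, h2]
  refine gain_eq_gain_of_orthogonal hω (hv.unit_norm _ k) (hv.unit_norm _ k)
    (fun j hj => hv.zero_forcing _ hω k j hj) (fun j hj => ?_) _
  have h1 : ∀ m, (a : ℂ) * ω.1 j m = scaled a (blockReflection A B ω).1 j m := by
    intro m
    simp [blockReflection, scaled, hA, hB, hj]
  simp only [h1]
  exact hv.zero_forcing _ hω' k j hj

/-- The interference is due to the unknown part of the channel only. -/
lemma IsZFPrecoder.ae_interference_eq (hv : IsZFPrecoder v) {a : ℝ} (b : ℝ)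
    (ha : a ≠ 0) {k j : Fin M} (hj : j ≠ k) :
    ∀ᵐ ω ∂(blockLaw M), gain (mixture a b ω k) (v (scaled a ω.1) j) =
      b ^ 2 * gain (ω.2 k) (v (scaled a ω.1) j) := by
  filter_upwards [ae_linearIndependent_fst (M := M) ha] with ω hω
  exact gain_add_of_orthogonal (hv.zero_forcing _ hω j k hj.symm) _ b

/-! ### Rates -/

/-- The instantaneous rate of the user `k` with channel `x` when the beams `V` have power `c`. -/
noncomputable def instRate (c : ℝ) (x : Fin M → ℂ) (V : Fin M → Fin M → ℂ) (k : Fin M) : ℝ :=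
  Real.log (1 + (c * gain x (V k)) / (1 + ∑ j ∈ Finset.univ.erase k, c * gain x (V j)))

lemma instRate_nonneg {c : ℝ} (hc : 0 ≤ c) (x : Fin M → ℂ) (V : Fin M → Fin M → ℂ) (k : Fin M) :
    0 ≤ instRate c x V k := by
  have hI : 0 ≤ ∑ j ∈ Finset.univ.erase k, c * gain x (V j) :=
    Finset.sum_nonneg fun j _ => mul_nonneg hc (gain_nonneg _ _)
  refine Real.log_nonneg ?_
  have := div_nonneg (mul_nonneg hc (gain_nonneg x (V k))) (add_nonneg zero_le_one hI)
  linarith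

lemma instRate_le {c : ℝ} (hc : 0 ≤ c) (x : Fin M → ℂ) (V : Fin M → Fin M → ℂ) (k : Fin M) :
    instRate c x V k ≤ c * gain x (V k) := by
  have hI : 0 ≤ ∑ j ∈ Finset.univ.erase k, c * gain x (V j) :=
    Finset.sum_nonneg fun j _ => mul_nonneg hc (gain_nonneg _ _)
  have hS := mul_nonneg hc (gain_nonneg x (V k))
  have h1 := div_nonneg hS (add_nonneg zero_le_one hI)
  have h2 := div_le_self hS (show 1 ≤ 1 + ∑ j ∈ Finset.univ.erase k, c * gain x (V j) by linarith)
  have h3 := Real.log_le_sub_one_of_pos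
    (show 0 < 1 + (c * gain x (V k)) / (1 + ∑ j ∈ Finset.univ.erase k, c * gain x (V j)) by
      linarith)
  unfold instRate
  linarith

/-- The rate is `log (1 + I + S) - log (1 + I)`; drop `I` in the first term and use `log (1 + I) ≤
I` in the second. Signal and interference need not be independent, since only their separate
expectations enter. -/
lemma le_instRate {c : ℝ} (hc : 0 ≤ c) (x : Fin M → ℂ) (V : Fin M → Fin M → ℂ) (k : Fin M) :
    Real.log (1 + c * gain x (V k)) - ∑ j ∈ Finset.univ.erase k, c * gain x (V j) ≤
      instRate c x V k := by
  unfold instRate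
  set I := ∑ j ∈ Finset.univ.erase k, c * gain x (V j) with hIdef
  have hI : 0 ≤ I := Finset.sum_nonneg fun j _ => mul_nonneg hc (gain_nonneg _ _)
  have hS := mul_nonneg hc (gain_nonneg x (V k))
  have h1 : Real.log (1 + c * gain x (V k)) ≤ Real.log (1 + I + c * gain x (V k)) :=
    Real.log_le_log (by linarith) (by linarith)
  have h2 : Real.log (1 + I) ≤ I := by
    have := Real.log_le_sub_one_of_pos (show 0 < 1 + I by linarith)
    linarith
  have h3 : 1 + c * gain x (V k) / (1 + I) = (1 + I + c * gain x (V k)) / (1 + I) := by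
    have : 1 + I ≠ 0 := by linarith
    field_simp
  rw [h3, Real.log_div (by linarith) (by linarith)]
  linarith

lemma measurable_instRate {α : Type*} [MeasurableSpace α] {f : α → Fin M → ℂ}
    {g : α → Fin M → Fin M → ℂ} (hf : Measurable f) (hg : Measurable g) (c : ℝ) (k : Fin M) :
    Measurable fun x => instRate c (f x) (g x) k := by
  have h : ∀ j, Measurable fun x => gain (f x) (g x j) :=
    fun j => measurable_gain hf ((measurable_pi_apply j).comp hg)
  have hI : Measurable fun x => ∑ j ∈ Finset.univ.erase k, c * gain (f x) (g x j) :=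
    Finset.measurable_fun_sum _ fun j _ => (h j).const_mul c
  have hq := ((h k).const_mul c).div (hI.const_add 1)
  exact Real.measurable_log.comp (hq.const_add 1)

/-- The ergodic rate when the channel is a mixture of a known and an unknown part. -/
noncomputable def mixtureRate (v : Channel M → Fin M → Fin M → ℂ) (c : ℝ) (k : Fin M)
    (a b : ℝ) : ℝ :=
  ∫ ω, instRate c (mixture a b ω k) (v (scaled a ω.1)) k ∂(blockLaw M)

/-- The ergodic rate without interference. -/
noncomputable def cleanRate (c : ℝ) : ℝ := ∫ x, Real.log (1 + c * ‖x‖ ^ 2) ∂stdComplexGaussian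

lemma integrable_log_clean {c : ℝ} (hc : 0 ≤ c) :
    Integrable (fun x : ℂ => Real.log (1 + c * ‖x‖ ^ 2)) stdComplexGaussian := by
  refine (integrable_normSq_stdComplexGaussian.const_mul c).mono' ?_
    (Filter.Eventually.of_forall fun x => ?_)
  · exact (Real.measurable_log.comp (by fun_prop)).aestronglyMeasurable
  · have h : 0 ≤ c * ‖x‖ ^ 2 := by positivity
    have h1 := Real.log_nonneg (show 1 ≤ 1 + c * ‖x‖ ^ 2 by linarith)
    have h2 := Real.log_le_sub_one_of_pos (show 0 < 1 + c * ‖x‖ ^ 2 by linarith)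
    rw [Real.norm_of_nonneg h1]
    linarith

lemma cleanRate_pos {c : ℝ} (hc : 0 < c) : 0 < cleanRate c := by
  have hnn : ∀ x : ℂ, 0 ≤ Real.log (1 + c * ‖x‖ ^ 2) := fun x =>
    Real.log_nonneg (by have : 0 ≤ c * ‖x‖ ^ 2 := by positivity
                        linarith)
  refine (integral_pos_iff_support_of_nonneg hnn (integrable_log_clean hc.le)).2 ?_
  have hsub : ({0} : Set ℂ)ᶜ ⊆ Function.support fun x : ℂ => Real.log (1 + c * ‖x‖ ^ 2) := by
    intro x hx
    have hx' : 0 < ‖x‖ := norm_pos_iff.2 hx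
    have : 0 < c * ‖x‖ ^ 2 := by positivity
    exact (Real.log_pos (by linarith)).ne'
  refine lt_of_lt_of_le ?_ (measure_mono hsub)
  rw [prob_compl_eq_one_sub (measurableSet_singleton 0), stdComplexGaussian_singleton_zero]
  simp

lemma IsZFPrecoder.identDistrib_log_signal (hv : IsZFPrecoder v) {a b : ℝ}
    (hab : a ^ 2 + b ^ 2 = 1) (ha : a ≠ 0) (c : ℝ) (k : Fin M) :
    IdentDistrib
      (fun ω : Block M => Real.log (1 + c * gain (mixture a b ω k) (v (scaled a ω.1) k)))
      (fun x : ℂ => Real.log (1 + c * ‖x‖ ^ 2)) (blockLaw M) stdComplexGaussian :=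
  (hv.identDistrib_signal hab ha k).comp (u := fun y => Real.log (1 + c * y))
    (Real.measurable_log.comp (by fun_prop))

lemma IsZFPrecoder.mixtureRate_one_zero (hv : IsZFPrecoder v) (c : ℝ) (k : Fin M) :
    mixtureRate v c k 1 0 = cleanRate c := by
  rw [cleanRate, mixtureRate,
    ← (hv.identDistrib_log_signal (a := 1) (b := 0) (by norm_num) one_ne_zero c k).integral_eq]
  refine integral_congr_ae ?_
  have h : ∀ᵐ ω ∂(blockLaw M), ∀ j, j ≠ k →
      gain (mixture 1 0 ω k) (v (scaled 1 ω.1) j) = 0 := by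
    rw [ae_all_iff]
    intro j
    by_cases hj : j = k
    · exact Filter.Eventually.of_forall fun ω h => absurd hj h
    · filter_upwards [hv.ae_interference_eq 0 one_ne_zero hj] with ω hω _
      rw [hω]
      ring
  filter_upwards [h] with ω hω
  have : ∑ j ∈ Finset.univ.erase k, c * gain (mixture 1 0 ω k) (v (scaled 1 ω.1) j) = 0 :=
    Finset.sum_eq_zero fun j hj => by rw [hω j (Finset.ne_of_mem_erase hj), mul_zero]
  rw [instRate, this, add_zero, div_one]

/-- Integrate `le_instRate`: the signal term has the law of the interference-free case, and each
foreign beam, being independent of `ω.2`, contributes mean `c * b ^ 2`. -/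
lemma IsZFPrecoder.cleanRate_sub_le_mixtureRate (hv : IsZFPrecoder v) {a b : ℝ}
    (hab : a ^ 2 + b ^ 2 = 1) (ha : a ≠ 0) {c : ℝ} (hc : 0 ≤ c) (k : Fin M) :
    cleanRate c - ((M : ℝ) - 1) * (c * b ^ 2) ≤ mixtureRate v c k a b := by
  have hlog := hv.identDistrib_log_signal hab ha c k
  have hlogint := hlog.symm.integrable_snd (integrable_log_clean hc)
  have hind : ∀ j, IdentDistrib (fun ω : Block M => gain (ω.2 k) (v (scaled a ω.1) j))
      (fun x : ℂ => ‖x‖ ^ 2) (blockLaw M) stdComplexGaussian := fun j =>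
    identDistrib_gain_independent (hv.measurable_beam a j) (fun u => hv.unit_norm _ j) k
  have hgint : ∀ j ∈ Finset.univ.erase k, Integrable
      (fun ω : Block M => c * gain (mixture a b ω k) (v (scaled a ω.1) j)) (blockLaw M) := by
    intro j hj
    refine Integrable.const_mul ?_ c
    refine (((hind j).symm.integrable_snd integrable_normSq_stdComplexGaussian).const_mul
      (b ^ 2)).congr ?_
    filter_upwards [hv.ae_interference_eq b ha (Finset.ne_of_mem_erase hj)] with ω hω
    exact hω.symm
  have hgval : ∀ j ∈ Finset.univ.erase k,
      ∫ ω, c * gain (mixture a b ω k) (v (scaled a ω.1) j) ∂(blockLaw M) = c * b ^ 2 := by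
    intro j hj
    rw [integral_const_mul,
      integral_congr_ae (hv.ae_interference_eq b ha (Finset.ne_of_mem_erase hj)),
      integral_const_mul, (hind j).integral_eq, integral_normSq_stdComplexGaussian, mul_one]
  have hval : ∫ ω, (Real.log (1 + c * gain (mixture a b ω k) (v (scaled a ω.1) k)) -
      ∑ j ∈ Finset.univ.erase k, c * gain (mixture a b ω k) (v (scaled a ω.1) j)) ∂(blockLaw M) =
      cleanRate c - ((M : ℝ) - 1) * (c * b ^ 2) := by
    rw [integral_sub hlogint (integrable_finsetSum _ hgint), hlog.integral_eq,
      integral_finsetSum _ hgint, Finset.sum_congr rfl hgval, Finset.sum_const,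
      Finset.card_erase_of_mem (Finset.mem_univ k), Finset.card_univ, Fintype.card_fin,
      nsmul_eq_mul, Nat.cast_sub (by have := k.pos; omega), Nat.cast_one]
    rfl
  rw [← hval]
  refine integral_mono (hlogint.sub (integrable_finsetSum _ hgint)) ?_ fun ω =>
    le_instRate hc _ _ k
  have hS := (hv.identDistrib_signal hab ha k).symm.integrable_snd
    integrable_normSq_stdComplexGaussian
  refine (hS.const_mul c).mono' ?_ (Filter.Eventually.of_forall fun ω => ?_)
  · have h1 : Measurable fun ω : Block M => mixture a b ω k :=
      (measurable_pi_apply k).comp (measurable_mixture a b)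
    have h2 : Measurable fun ω : Block M => v (scaled a ω.1) :=
      hv.measurable.comp ((measurable_scaled a).comp measurable_fst)
    exact (measurable_instRate h1 h2 c k).aestronglyMeasurable
  · rw [Real.norm_of_nonneg (instRate_nonneg hc _ _ k)]
    exact instRate_le hc _ _ k

/-! ### The MMSE estimate -/

lemma measurable_observation (f P τ : ℝ) : Measurable (observation M f P τ) := by
  have : Continuous (observation M f P τ) := by
    unfold observation
    fun_prop
  exact this.measurable

lemma indepFun_blockReflection {a b : Fin M → ℝ} (hab : ∀ i, a i ^ 2 + b i ^ 2 = 1) :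
    IndepFun (fun ω => (blockReflection a b ω).1) (fun ω => (blockReflection a b ω).2)
      (blockLaw M) := by
  have hR := measurePreserving_blockReflection hab
  have h1 := measurePreserving_fst (μ := iidGaussian M) (ν := iidGaussian M)
  have h2 := measurePreserving_snd (μ := iidGaussian M) (ν := iidGaussian M)
  have m1 : Measurable fun ω => (blockReflection a b ω).1 := measurable_fst.comp hR.measurable
  have m2 : Measurable fun ω => (blockReflection a b ω).2 := measurable_snd.comp hR.measurable
  rw [indepFun_iff_map_prod_eq_prod_map_map m1.aemeasurable m2.aemeasurable]
  have e1 : (blockLaw M).map (fun ω => (blockReflection a b ω).1) = iidGaussian M :=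
    (h1.comp hR).map_eq
  have e2 : (blockLaw M).map (fun ω => (blockReflection a b ω).2) = iidGaussian M :=
    (h2.comp hR).map_eq
  rw [e1, e2]
  exact hR.map_eq

lemma measurePreserving_coefficient (k m : Fin M) :
    MeasurePreserving (fun G : Channel M => G k m) (iidGaussian M) stdComplexGaussian :=
  (measurePreserving_eval (fun _ : Fin M => stdComplexGaussian) m).comp (measurePreserving_row k)

lemma measurePreserving_fst_coefficient (k m : Fin M) :
    MeasurePreserving (fun ω : Block M => ω.1 k m) (blockLaw M) stdComplexGaussian :=
  (measurePreserving_coefficient k m).comp measurePreserving_fst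

lemma measurePreserving_snd_coefficient (k m : Fin M) :
    MeasurePreserving (fun ω : Block M => ω.2 k m) (blockLaw M) stdComplexGaussian :=
  (measurePreserving_coefficient k m).comp measurePreserving_snd

/-- If the observation is a multiple of the first component of a reflected block, then the MMSE
estimate is the known part of the channel in the reflected coordinates. -/
lemma mmseEstimate_ae_eq {f P τ s a b : ℝ} (hab : a ^ 2 + b ^ 2 = 1) (hs : s ≠ 0)
    (hobs : ∀ ω : Block M, ∀ k m, observation M f P τ ω k m = s * mixture a b ω k m) :
    ∀ᵐ ω ∂(blockLaw M), mmseEstimate M f P τ ω = scaled a (mixture a b ω) := by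
  set Φ : Block M → Block M := blockReflection (fun _ => a) (fun _ => b) with hΦ
  have hR : MeasurePreserving Φ (blockLaw M) (blockLaw M) :=
    measurePreserving_blockReflection fun _ => hab
  have hle : MeasurableSpace.comap (observation M f P τ) inferInstance ≤
      (inferInstance : MeasurableSpace (Block M)) := (measurable_observation f P τ).comap_le
  have hsc : (s : ℂ) ≠ 0 := by exact_mod_cast hs
  have hobs' : ∀ ω, observation M f P τ ω = scaled s (Φ ω).1 := fun ω =>
    funext₂ fun k m => hobs ω k m
  have hind : IndepFun (fun ω => (Φ ω).2) (observation M f P τ) (blockLaw M) := by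
    have h := (indepFun_blockReflection (M := M) (a := fun _ => a) (b := fun _ => b)
      fun _ => hab).symm.comp measurable_id (measurable_scaled s)
    have e : observation M f P τ = scaled s ∘ fun ω => (Φ ω).1 := funext hobs'
    rw [e]
    exact h
  have key : ∀ k m, (fun ω => mmseEstimate M f P τ ω k m) =ᵐ[blockLaw M]
      fun ω => (a : ℂ) * (Φ ω).1 k m := by
    intro k m
    have i1 : Integrable (fun ω : Block M => (a : ℂ) * (Φ ω).1 k m) (blockLaw M) :=
      ((((measurePreserving_fst_coefficient k m).comp hR).integrable_comp
        integrable_id_stdComplexGaussian.aestronglyMeasurable).2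
          integrable_id_stdComplexGaussian).const_mul _
    have i2 : Integrable (fun ω : Block M => (b : ℂ) * (Φ ω).2 k m) (blockLaw M) :=
      ((((measurePreserving_snd_coefficient k m).comp hR).integrable_comp
        integrable_id_stdComplexGaussian.aestronglyMeasurable).2
          integrable_id_stdComplexGaussian).const_mul _
    have hdec : (fun ω : Block M => ω.1 k m) =
        (fun ω => (a : ℂ) * (Φ ω).1 k m) + fun ω => (b : ℂ) * (Φ ω).2 k m := by
      funext ω
      have h := blockReflection_blockReflection (M := M) (a := fun _ => a) (b := fun _ => b)
        (fun _ => hab) ω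
      exact (congrFun (congrFun (congrArg Prod.fst h) k) m).symm
    -- The first part of the decomposition is `a / s` times the observation, so conditioning leaves
    -- it unchanged; the second is independent of the observation and centred, so it disappears.
    have m1 : StronglyMeasurable[MeasurableSpace.comap (observation M f P τ) inferInstance]
        fun ω : Block M => (a : ℂ) * (Φ ω).1 k m := by
      have e : (fun ω : Block M => (a : ℂ) * (Φ ω).1 k m) =
          (fun y : Channel M => (a : ℂ) * ((s : ℂ)⁻¹ * y k m)) ∘ observation M f P τ := by
        funext ω
        simp only [Function.comp, hobs', scaled, inv_mul_cancel_left₀ hsc]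
      rw [e]
      have hmeas : Measurable fun y : Channel M => (a : ℂ) * ((s : ℂ)⁻¹ * y k m) :=
        ((measurePreserving_coefficient k m).measurable.const_mul _).const_mul _
      exact (hmeas.comp (comap_measurable _)).stronglyMeasurable
    have m2 : StronglyMeasurable[MeasurableSpace.comap (fun ω => (Φ ω).2) inferInstance]
        fun ω : Block M => (b : ℂ) * (Φ ω).2 k m := by
      have hmeas : Measurable fun y : Channel M => (b : ℂ) * y k m :=
        (measurePreserving_coefficient k m).measurable.const_mul _
      exact (hmeas.comp (comap_measurable fun ω => (Φ ω).2)).stronglyMeasurable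
    have hmean : ∫ ω, (b : ℂ) * (Φ ω).2 k m ∂(blockLaw M) = 0 := by
      have h := (measurePreserving_snd_coefficient k m).comp hR
      have h0 : ∫ ω, (Φ ω).2 k m ∂(blockLaw M) = ∫ x, x ∂stdComplexGaussian := by
        have hint := integral_map (μ := blockLaw M) (f := fun x : ℂ => x) h.measurable.aemeasurable
          measurable_id.aestronglyMeasurable
        rw [h.map_eq] at hint
        exact hint.symm
      rw [integral_const_mul, h0, integral_id_stdComplexGaussian, mul_zero]
    have c1 := condExp_of_stronglyMeasurable hle m1 i1
    have c2 := condExp_indep_eq (μ := blockLaw M)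
      (measurable_snd.comp hR.measurable).comap_le hle m2 hind
    have c3 := condExp_add i1 i2 (MeasurableSpace.comap (observation M f P τ) inferInstance)
    rw [← hdec, c1] at c3
    filter_upwards [c2, c3] with ω h2 h3
    unfold mmseEstimate
    rw [h3, Pi.add_apply, h2, hmean, add_zero]
  have key' : ∀ᵐ ω ∂(blockLaw M), ∀ k m, mmseEstimate M f P τ ω k m = (a : ℂ) * (Φ ω).1 k m := by
    rw [ae_all_iff]
    intro k
    rw [ae_all_iff]
    exact key k
  filter_upwards [key'] with ω hω
  exact funext₂ fun k m => hω k m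

lemma IsZFPrecoder.rateZF_eq (hv : IsZFPrecoder v) (P : ℝ) (k : Fin M) :
    rateZF v P k = cleanRate (P / M) := by
  rw [← hv.mixtureRate_one_zero]
  have h1 : ∀ ω : Block M, mixture 1 0 ω = ω.1 := fun ω => by
    ext i m
    simp [mixture]
  have h2 : ∀ u : Channel M, scaled 1 u = u := fun u => by
    ext i m
    simp [scaled]
  simp only [mixtureRate, h1, h2]
  rfl

lemma IsZFPrecoder.rateData_eq_mixtureRate (hv : IsZFPrecoder v) {f P τ s a b : ℝ}
    (hab : a ^ 2 + b ^ 2 = 1) (hs : s ≠ 0)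
    (hobs : ∀ ω : Block M, ∀ k m, observation M f P τ ω k m = s * mixture a b ω k m)
    (k : Fin M) : rateData v f P k τ = mixtureRate v (P / M) k a b := by
  set Φ : Block M → Block M := blockReflection (fun _ => a) (fun _ => b) with hΦ
  have hR : MeasurePreserving Φ (blockLaw M) (blockLaw M) :=
    measurePreserving_blockReflection fun _ => hab
  have h1 : Measurable fun ω : Block M => mixture a b ω k :=
    (measurable_pi_apply k).comp (measurable_mixture a b)
  have h2 : Measurable fun ω : Block M => v (scaled a ω.1) :=
    hv.measurable.comp ((measurable_scaled a).comp measurable_fst)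
  have hmeas := (measurable_instRate h1 h2 (P / M) k).aestronglyMeasurable (μ := blockLaw M)
  -- Change of variables along `Φ`, which preserves the law: afterwards `mixture a b (Φ ω)` is the
  -- true channel and `scaled a (Φ ω).1` the estimate.
  have hmix : mixtureRate v (P / M) k a b =
      ∫ ω, instRate (P / M) (mixture a b (Φ ω) k) (v (scaled a (Φ ω).1)) k ∂(blockLaw M) := by
    unfold mixtureRate
    conv_lhs => rw [← hR.map_eq]
    rw [integral_map hR.measurable.aemeasurable (by rw [hR.map_eq]; exact hmeas)]
  rw [hmix]
  change ∫ ω, instRate (P / M) (ω.1 k) (v (mmseEstimate M f P τ ω)) k ∂(blockLaw M) = _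
  refine integral_congr_ae ?_
  filter_upwards [mmseEstimate_ae_eq hab hs hobs] with ω hω
  have hback : mixture a b (Φ ω) = ω.1 :=
    congrArg Prod.fst (blockReflection_blockReflection (M := M) (a := fun _ => a)
      (b := fun _ => b) (fun _ => hab) ω)
  rw [hω, hback]
  rfl

/-- The rate loss due to imperfect channel knowledge is at most `(M - 1) / (f τ)`. -/
lemma IsZFPrecoder.rateZF_sub_le_rateData (hv : IsZFPrecoder v) {f P τ : ℝ} (hf : 0 < f)
    (hP : 0 < P) (hτ : 0 < τ) (k : Fin M) :
    rateZF v P k - ((M : ℝ) - 1) / (f * τ) ≤ rateData v f P k τ := by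
  have hM : (1 : ℝ) ≤ M := by exact_mod_cast k.pos
  have hM0 : (0 : ℝ) < M := by linarith
  set q := τ * f * P / M with hq
  have hq0 : 0 < q := by positivity
  set s := Real.sqrt (1 + q) with hs
  have hs0 : 0 < s := Real.sqrt_pos.2 (by linarith)
  have hs2 : s ^ 2 = 1 + q := Real.sq_sqrt (by linarith)
  have hr0 : 0 < Real.sqrt q := Real.sqrt_pos.2 hq0
  have hr2 : Real.sqrt q ^ 2 = q := Real.sq_sqrt hq0.le
  have hab : (Real.sqrt q / s) ^ 2 + (1 / s) ^ 2 = 1 := by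
    rw [div_pow, div_pow, hr2, hs2]
    field_simp
    ring
  have hsc : (s : ℂ) ≠ 0 := by exact_mod_cast hs0.ne'
  have hobs : ∀ ω : Block M, ∀ k m, observation M f P τ ω k m =
      s * mixture (Real.sqrt q / s) (1 / s) ω k m := by
    intro ω k m
    simp only [observation, mixture, ← hq]
    push_cast
    field_simp
  rw [hv.rateZF_eq, hv.rateData_eq_mixtureRate hab hs0.ne' hobs]
  refine le_trans ?_ (hv.cleanRate_sub_le_mixtureRate hab (div_pos hr0 hs0).ne'
    (div_pos hP hM0).le k)
  -- The left side equals `P / (M + τ f P)`; dropping `M` from the denominator removes the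
  -- dependence on the power.
  have hnoise : P / M * (1 / s) ^ 2 ≤ 1 / (f * τ) := by
    rw [div_pow, hs2, one_pow, mul_one_div, div_div, div_le_div_iff₀ (by positivity) (by positivity)]
    have : (M : ℝ) * (1 + q) = M + τ * f * P := by
      rw [hq]
      field_simp
    rw [this]
    linarith
  have := mul_le_mul_of_nonneg_left hnoise (sub_nonneg.2 hM)
  rw [mul_one_div] at this
  linarith

lemma rateData_nonneg {P : ℝ} (hP : 0 ≤ P) (f τ : ℝ) (k : Fin M) : 0 ≤ rateData v f P k τ :=
  integral_nonneg fun ω =>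
    instRate_nonneg (div_nonneg hP (Nat.cast_nonneg M)) (ω.1 k) (v (mmseEstimate M f P τ ω)) k

/-- A crude Cauchy–Schwarz bound, valid for any unit beams. It is uniform in `τ` and covers `τ = 0`,
as boundedness of `arHD` requires. -/
lemma IsZFPrecoder.rateData_le (hv : IsZFPrecoder v) {P : ℝ} (hP : 0 ≤ P) (f τ : ℝ) (k : Fin M) :
    rateData v f P k τ ≤ ∫ ω, P / M * ∑ m, ‖ω.1 k m‖ ^ 2 ∂(blockLaw M) := by
  have hc : 0 ≤ P / M := div_nonneg hP (Nat.cast_nonneg M)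
  refine integral_mono_of_nonneg (Filter.Eventually.of_forall fun ω =>
    instRate_nonneg hc (ω.1 k) (v (mmseEstimate M f P τ ω)) k) ?_
    (Filter.Eventually.of_forall fun ω => ?_)
  · refine (integrable_finsetSum _ fun m _ => ?_).const_mul _
    exact ((measurePreserving_fst_coefficient k m).integrable_comp
      integrable_normSq_stdComplexGaussian.aestronglyMeasurable).2
        integrable_normSq_stdComplexGaussian
  · exact (instRate_le hc (ω.1 k) (v (mmseEstimate M f P τ ω)) k).trans
      (mul_le_mul_of_nonneg_left (gain_le (hv.unit_norm _ k)) hc)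

lemma IsZFPrecoder.bddAbove_arHD (hv : IsZFPrecoder v) {P T : ℝ} (hP : 0 ≤ P) (hT : 0 < T) (f : ℝ)
    (k : Fin M) : BddAbove (arHD v f P k T '' Set.Ico 0 T) := by
  refine ⟨∫ ω, P / M * ∑ m, ‖ω.1 k m‖ ^ 2 ∂(blockLaw M), ?_⟩
  rintro _ ⟨τ, hτ, rfl⟩
  refine le_trans ?_ (hv.rateData_le hP f τ k)
  refine mul_le_of_le_one_left (rateData_nonneg hP f τ k) ?_
  rw [div_le_one hT]
  linarith [hτ.1]

/-! ### The training duration -/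

/-- The positive root of `c τ² + τ = T`. -/
lemma posRoot_spec {c T : ℝ} (hc : 0 < c) (hT : 0 < T) :
    0 < (Real.sqrt (4 * c * T + 1) - 1) / (2 * c) ∧
      c * ((Real.sqrt (4 * c * T + 1) - 1) / (2 * c)) ^ 2 +
        (Real.sqrt (4 * c * T + 1) - 1) / (2 * c) = T := by
  have hcT : 0 < 4 * c * T := by positivity
  have hsq : Real.sqrt (4 * c * T + 1) ^ 2 = 4 * c * T + 1 := Real.sq_sqrt (by linarith)
  have hgt : 1 < Real.sqrt (4 * c * T + 1) := Real.lt_sqrt_of_sq_lt (by linarith)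
  refine ⟨div_pos (by linarith) (by linarith), ?_⟩
  generalize Real.sqrt (4 * c * T + 1) = r at hsq
  field_simp
  linear_combination hsq

/-- The left side is the overhead `R τ / T` plus the weighted rate loss `(T - τ) / T * (N / τ)`.
They coincide exactly when `c τ ^ 2 = T - τ`, whence the factor `2`. -/
lemma loss_bound_at_root {c N T R τ : ℝ} (hc : 0 < c) (hN : 0 < N) (hT : 0 < T) (hR : R = c * N)
    (hτ : 0 < τ) (hroot : c * τ ^ 2 + τ = T) :
    R - (T - τ) / T * (R - N / τ) ≤ 2 * Real.sqrt (N * R / T) := by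
  have hval : R - (T - τ) / T * (R - N / τ) = 2 * (R * τ / T) := by
    have h1 : T - τ = c * τ ^ 2 := by linarith
    rw [h1, hR]
    field_simp
    linear_combination -hroot
  rw [hval]
  refine mul_le_mul_of_nonneg_left (Real.le_sqrt_of_sq_le ?_) (by norm_num)
  -- Discarding `τ` from the quadratic equation gives `τ ≤ √(T / c)`, which turns the exact value
  -- into the square-root bound.
  have hτ2 : c * τ ^ 2 ≤ T := by linarith
  have h2 : (R * τ / T) ^ 2 = (c * N ^ 2) * (c * τ ^ 2) / T ^ 2 := by
    rw [hR]
    ring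
  have h3 : N * R / T = (c * N ^ 2) * T / T ^ 2 := by
    rw [hR]
    field_simp
  rw [h2, h3]
  gcongr

end HalfDuplex

theorem theorem5 (M : ℕ) (hM : 2 ≤ M) (P f T : ℝ) (hP : 0 < P) (hf : f ∈ Set.Ioc (0 : ℝ) 1)
    (hT : 0 < T) (v : HalfDuplex.Channel M → Fin M → Fin M → ℂ) (hv : HalfDuplex.IsZFPrecoder v)
    (k : Fin M) :
    HalfDuplex.approxOptHD v f P k T ∈ Set.Ioo 0 T ∧
    BddAbove (HalfDuplex.arHD v f P k T '' Set.Ico 0 T) ∧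
    HalfDuplex.rateZF v P k - sSup (HalfDuplex.arHD v f P k T '' Set.Ico 0 T) ≤
      HalfDuplex.lossHD v f P k T (HalfDuplex.approxOptHD v f P k T) ∧
    (∀ Topt ∈ Set.Ico 0 T, IsMaxOn (HalfDuplex.arHD v f P k T) (Set.Ico 0 T) Topt →
      HalfDuplex.lossHD v f P k T Topt ≤
        HalfDuplex.lossHD v f P k T (HalfDuplex.approxOptHD v f P k T)) ∧
    HalfDuplex.lossHD v f P k T (HalfDuplex.approxOptHD v f P k T) ≤
      2 * Real.sqrt (((M : ℝ) - 1) * HalfDuplex.rateZF v P k / (f * T)) := by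
  have hM2 : (2 : ℝ) ≤ M := by exact_mod_cast hM
  have hf0 : 0 < f := hf.1
  have hM1 : 0 < (M : ℝ) - 1 := by linarith
  have hR : 0 < HalfDuplex.rateZF v P k := by
    rw [hv.rateZF_eq]
    exact HalfDuplex.cleanRate_pos (by positivity)
  have hc : 0 < HalfDuplex.cHD v f P k := div_pos (mul_pos hf0 hR) hM1
  have hroot : 0 < HalfDuplex.approxOptHD v f P k T ∧
      HalfDuplex.cHD v f P k * HalfDuplex.approxOptHD v f P k T ^ 2 +
        HalfDuplex.approxOptHD v f P k T = T := HalfDuplex.posRoot_spec hc hT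
  obtain ⟨hτ, heq⟩ := hroot
  have hτT : HalfDuplex.approxOptHD v f P k T < T := by
    have : 0 < HalfDuplex.cHD v f P k * HalfDuplex.approxOptHD v f P k T ^ 2 := by positivity
    linarith
  have hmem : HalfDuplex.approxOptHD v f P k T ∈ Set.Ico 0 T := ⟨hτ.le, hτT⟩
  have hbdd := hv.bddAbove_arHD hP.le hT f k
  refine ⟨⟨hτ, hτT⟩, hbdd, ?_, fun Topt hTopt hmax => ?_, ?_⟩
  · exact sub_le_sub_left (le_csSup hbdd (Set.mem_image_of_mem _ hmem)) _
  · exact sub_le_sub_left (hmax hmem) _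
  -- The rate loss is `N / τ` with `N = (M - 1) / f`, and `cHD` is precisely `R / N`.
  · have hRcN : HalfDuplex.rateZF v P k = HalfDuplex.cHD v f P k * (((M : ℝ) - 1) / f) := by
      unfold HalfDuplex.cHD
      field_simp
    have hbound := HalfDuplex.loss_bound_at_root hc (div_pos hM1 hf0) hT hRcN hτ heq
    have hdata := hv.rateZF_sub_le_rateData hf0 hP hτ k
    rw [← div_div] at hdata
    have hfrac : 0 ≤ (T - HalfDuplex.approxOptHD v f P k T) / T :=
      div_nonneg (by linarith) hT.le
    have harg : ((M : ℝ) - 1) / f * HalfDuplex.rateZF v P k / T =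
        ((M : ℝ) - 1) * HalfDuplex.rateZF v P k / (f * T) := by
      field_simp
    rw [harg] at hbound
    exact (sub_le_sub_left (mul_le_mul_of_nonneg_left hdata hfrac) _).trans hbound
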